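/- Let $\Bbbk$ be an algebraically closed field of characteristic zero, let $\mathfrak g=\mathfrak{sl}_2(\Bbbk)$ with standard basis $\mathrm e,\mathrm h,\mathrm f$, let $\mathcal A=\Bbbk[t,t^{-1}]$, and let $\hat{\mathfrak g}=\mathfrak g\otimes\mathcal A$ be the loop algebra, with bracket $[x\otimes a,y\otimes b]=[x,y]\otimes ab$. Let $\mathcal A$ act on the space of all functions $\varphi:\mathbb Z\to\Bbbk$ by $(t^n\cdot\varphi)(m)=\varphi(m+n)$. A function $\varphi:\mathbb Z\to\Bbbk$ is exponential polynomial if it is a finite sum $\varphi(m)=\sum_{\lambda\in\Bbbk^\times}\varphi_\lambda(m)\lambda^m$ with polynomial functions $\varphi_\lambda$; its characteristic polynomial $c_\varphi\in\Bbbk[t]$ is the monic generator of the (non-zero) ideal $\{c\in\Bbbk[t] : c\cdot\varphi=0\}$. For such $\varphi$, let $\Bbbk v_\varphi$ be the one-dimensional module over the subalgebra $(\Bbbk\mathrm h\oplus\Bbbk\mathrm e)\otimes\mathcal A$ of $\hat{\mathfrak g}$ on which $\mathrm h\otimes a$ acts by the scalar $(a\cdot\varphi)(0)$ and $\mathrm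 e\otimes a$ acts by $0$, for all $a\in\mathcal A$, and let $L(\varphi)$ be the unique irreducible quotient of the $\hat{\mathfrak g}$-module induced from $\Bbbk v_\varphi$. Proposition. Let $\varphi_1,\varphi_2:\mathbb Z\to\Bbbk$ be exponential-polynomial functions whose characteristic polynomials $c_{\varphi_1}$ and $c_{\varphi_2}$ are coprime. Then $$L(\varphi_1+\varphi_2)\;\cong\;L(\varphi_1)\otimes_{\Bbbk}L(\varphi_2)$$ as $\hat{\mathfrak g}$-modules. -/

import Mathlib

open scoped TensorProduct LaurentPolynomial

noncomputable section

namespace ExpPolyLoop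

/-! ### Exponential-polynomial functions and their characteristic polynomials -/

section Functions

variable {k : Type*} [Field k]

/-- `φ : ℤ → k` is exponential polynomial: a finite sum `∑_μ p_μ(m) μ^m` over distinct
nonzero scalars `μ`, with polynomial coefficient functions `p_μ`. -/
def IsExpPoly (φ : ℤ → k) : Prop :=
  ∃ p : kˣ →₀ Polynomial k,
    ∀ m : ℤ, φ m = p.sum fun μ q => q.eval (m : k) * ((μ ^ m : kˣ) : k)

variable (k) in
/-- The action of the Laurent polynomials on all functions `ℤ → k`, in which `T n` acts by
the shift `(T n · φ) m = φ (m + n)`. -/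
def laurentAction : k[T;T⁻¹] →ₐ[k] Module.End k (ℤ → k) :=
  AddMonoidAlgebra.lift k (Module.End k (ℤ → k)) ℤ
    { toFun := fun n => LinearMap.funLeft k k (fun m : ℤ => m + n.toAdd)
      map_one' := by ext; simp [LinearMap.funLeft_apply]
      map_mul' := fun a b => by
        ext φ m
        simp [LinearMap.funLeft_apply, add_assoc] }

theorem laurentAction_T (n : ℤ) (φ : ℤ → k) (m : ℤ) :
    laurentAction k (LaurentPolynomial.T n) φ m = φ (m + n) := by
  unfold laurentAction LaurentPolynomial.T
  rw [AddMonoidAlgebra.lift_single, one_smul]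
  rfl

/-- The annihilator of `φ` in the polynomial ring `k[t]`. -/
def annihilator (φ : ℤ → k) : Ideal (Polynomial k) where
  carrier := {c | laurentAction k (Polynomial.toLaurent c) φ = 0}
  add_mem' := fun {a b} ha hb => by
    simp only [Set.mem_ofPred_eq, map_add, LinearMap.add_apply] at *
    rw [ha, hb, add_zero]
  zero_mem' := by simp
  smul_mem' := fun c x hx => by
    simp only [Set.mem_ofPred_eq, smul_eq_mul, map_mul, Module.End.mul_apply] at *
    rw [hx, map_zero]

/-- The characteristic polynomial of `φ`: the monic generator of its annihilator (a generator
divided by its leading coefficient). -/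
def charPoly (φ : ℤ → k) : Polynomial k :=
  Polynomial.C (Submodule.IsPrincipal.generator (annihilator φ)).leadingCoeff⁻¹ *
    Submodule.IsPrincipal.generator (annihilator φ)

end Functions

/-! ### Modules induced from characters, and their irreducible quotients -/

section Induced

variable {k L : Type*} [Field k] [LieRing L] [LieAlgebra k L]

/-- The `L`-module `Ind_B^L k_χ = U(L) ⊗_{U(B)} k_χ` induced from the one-dimensional
`B`-module with character `χ`, realised as the quotient of `U(L)` by the left ideal generated
by the elements `x - χ(x)`, `x ∈ B`. -/
def Induced (B : LieSubalgebra k L) (χ : LieAlgebra.LieCharacter k B) : Type _ :=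
  UniversalEnvelopingAlgebra k L ⧸
    Submodule.span (UniversalEnvelopingAlgebra k L) (Set.range fun x : B =>
      UniversalEnvelopingAlgebra.ι k (x : L) -
        algebraMap k (UniversalEnvelopingAlgebra k L) (χ x))

variable (B : LieSubalgebra k L) (χ : LieAlgebra.LieCharacter k B)

instance : AddCommGroup (Induced B χ) :=
  inferInstanceAs (AddCommGroup (UniversalEnvelopingAlgebra k L ⧸ Submodule.span _ _))

instance : Module (UniversalEnvelopingAlgebra k L) (Induced B χ) :=
  inferInstanceAs (Module _ (UniversalEnvelopingAlgebra k L ⧸ Submodule.span _ _))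

instance : Module k (Induced B χ) :=
  inferInstanceAs (Module k (UniversalEnvelopingAlgebra k L ⧸ Submodule.span _ _))

instance : IsScalarTower k (UniversalEnvelopingAlgebra k L) (Induced B χ) :=
  inferInstanceAs (IsScalarTower k (UniversalEnvelopingAlgebra k L)
    (UniversalEnvelopingAlgebra k L ⧸ Submodule.span _ _))

/-- `L` acts on the induced module through `L → U(L)`. -/
instance : LieRingModule L (Induced B χ) where
  bracket x v := UniversalEnvelopingAlgebra.ι k x • v
  add_lie x y v := by
    change UniversalEnvelopingAlgebra.ι k (x + y) • v = _
    rw [map_add, add_smul]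
  lie_add x v w := smul_add _ v w
  leibniz_lie x y v := by
    change UniversalEnvelopingAlgebra.ι k x • UniversalEnvelopingAlgebra.ι k y • v =
      UniversalEnvelopingAlgebra.ι k ⁅x, y⁆ • v +
      UniversalEnvelopingAlgebra.ι k y • UniversalEnvelopingAlgebra.ι k x • v
    let : LieRing (UniversalEnvelopingAlgebra k L) := LieRing.ofAssociativeRing
    rw [LieHom.map_lie, LieRing.of_associative_ring_bracket, sub_smul, mul_smul, mul_smul]
    abel

instance : LieModule k L (Induced B χ) where
  smul_lie c x v := by
    change UniversalEnvelopingAlgebra.ι k (c • x) • v =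
      c • UniversalEnvelopingAlgebra.ι k x • v
    rw [map_smul, smul_assoc]
  lie_smul c x v := by
    change UniversalEnvelopingAlgebra.ι k x • c • v =
      c • UniversalEnvelopingAlgebra.ι k x • v
    rw [← algebraMap_smul (UniversalEnvelopingAlgebra k L) c v,
      ← algebraMap_smul (UniversalEnvelopingAlgebra k L) c
        (UniversalEnvelopingAlgebra.ι k x • v), ← mul_smul, ← mul_smul, Algebra.commutes]

/-- The sum of all proper submodules of a module. For a highest-weight module this is its
unique maximal proper submodule. -/
def sumProper (k L M : Type*) [CommRing k] [LieRing L] [AddCommGroup M] [Module k M]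
    [LieRingModule L M] : LieSubmodule k L M :=
  sSup {N | N ≠ ⊤}

end Induced

/-! ### The loop algebra of `sl₂` and its highest-weight modules -/

section Loop

variable (k : Type*) [Field k]

/-- The Lie algebra `𝔤 = sl₂` of traceless `2 × 2` matrices. -/
abbrev SL2 : Type _ := LieAlgebra.SpecialLinear.sl (Fin 2) k

/-- The standard basis vector `e`. -/
def e : SL2 k := ⟨!![0, 1; 0, 0], by
  simp [LieAlgebra.SpecialLinear.sl, Matrix.trace_fin_two]⟩

/-- The standard basis vector `h`. -/
def h : SL2 k := ⟨!![1, 0; 0, -1], by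
  simp [LieAlgebra.SpecialLinear.sl, Matrix.trace_fin_two]⟩

theorem lie_h_e : ⁅h k, e k⁆ = (2 : k) • e k := by
  apply Subtype.ext
  rw [LieAlgebra.SpecialLinear.sl_bracket]
  ext i j
  fin_cases i <;> fin_cases j <;>
    norm_num [h, e, Matrix.mul_apply]

/-- The loop algebra `𝔤̂ = k[t, t⁻¹] ⊗ 𝔤`. -/
def LoopSL2 : Type _ := LieAlgebra.loopAlgebra k ℤ (SL2 k)

instance : LieRing (LoopSL2 k) := inferInstanceAs (LieRing (LieAlgebra.loopAlgebra k ℤ (SL2 k)))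

instance : LieAlgebra k (LoopSL2 k) :=
  inferInstanceAs (LieAlgebra k (LieAlgebra.loopAlgebra k ℤ (SL2 k)))

variable {k} in
/-- The map `a ↦ x ⊗ a` from the Laurent polynomials to the loop algebra (Mathlib writes the
factors of the loop algebra in the opposite order). -/
def loopElt (x : SL2 k) : k[T;T⁻¹] →ₗ[k] LoopSL2 k :=
  (TensorProduct.mk k k[T;T⁻¹] (SL2 k)).flip x

theorem lie_loopElt (x y : SL2 k) (a b : k[T;T⁻¹]) :
    ⁅loopElt x a, loopElt y b⁆ = loopElt ⁅x, y⁆ (a * b) :=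
  LieAlgebra.ExtendScalars.bracket_tmul k k[T;T⁻¹] (SL2 k) (SL2 k) a b x y

theorem lie_borel (a b c d : k[T;T⁻¹]) :
    ⁅loopElt (h k) a + loopElt (e k) b, loopElt (h k) c + loopElt (e k) d⁆ =
      loopElt (e k) ((2 : k) • (a * d - c * b)) := by
  have hs : ∀ p : k[T;T⁻¹], loopElt ((2 : k) • e k) p = (2 : k) • loopElt (e k) p :=
    fun p => TensorProduct.tmul_smul _ _ _
  have h1 : ⁅loopElt (h k) a, loopElt (h k) c⁆ = 0 := by
    rw [lie_loopElt, lie_self]; exact TensorProduct.tmul_zero _ _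
  have h2 : ⁅loopElt (e k) b, loopElt (e k) d⁆ = 0 := by
    rw [lie_loopElt, lie_self]; exact TensorProduct.tmul_zero _ _
  have h3 : ⁅loopElt (h k) a, loopElt (e k) d⁆ = (2 : k) • loopElt (e k) (a * d) := by
    rw [lie_loopElt, lie_h_e, hs]
  have h4 : ⁅loopElt (e k) b, loopElt (h k) c⁆ = -((2 : k) • loopElt (e k) (c * b)) := by
    rw [← lie_skew, lie_loopElt, lie_h_e, hs]
  rw [add_lie, lie_add, lie_add, h1, h2, h3, h4, map_smul, map_sub, smul_sub]
  abel

/-- The subalgebra `𝔥̂ + 𝔤̂₊` of the loop algebra, where `𝔥 = k h` and `𝔤₊ = k e`. -/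
def borel : LieSubalgebra k (LoopSL2 k) where
  toSubmodule := LinearMap.range (loopElt (h k)) ⊔ LinearMap.range (loopElt (e k))
  lie_mem' := fun {x y} hx hy => by
    obtain ⟨_, ⟨a, rfl⟩, _, ⟨b, rfl⟩, rfl⟩ := Submodule.mem_sup.1 hx
    obtain ⟨_, ⟨c, rfl⟩, _, ⟨d, rfl⟩, rfl⟩ := Submodule.mem_sup.1 hy
    refine Submodule.mem_sup_right ?_
    rw [lie_borel]
    exact ⟨_, rfl⟩

variable {k}

/-- The linear functional on the loop algebra with `a ⊗ h ↦ (a · φ)(0)`, `a ⊗ e ↦ 0`,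
`a ⊗ f ↦ 0`; the entry `x 0 0` is the coefficient of `h` in `x ∈ sl₂`. -/
def weightFunctional (φ : ℤ → k) : LoopSL2 k →ₗ[k] k :=
  TensorProduct.lift (LinearMap.mk₂ k
    (fun (a : k[T;T⁻¹]) (x : SL2 k) => laurentAction k a φ 0 * (x : Matrix (Fin 2) (Fin 2) k) 0 0)
    (fun a b x => by simp [add_mul])
    (fun c a x => by simp [mul_assoc])
    (fun a x y => by simp [mul_add])
    (fun c a x => by simp [mul_left_comm]))

theorem weightFunctional_loopElt (φ : ℤ → k) (x : SL2 k) (a : k[T;T⁻¹]) :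
    weightFunctional φ (loopElt x a) =
      laurentAction k a φ 0 * (x : Matrix (Fin 2) (Fin 2) k) 0 0 :=
  TensorProduct.lift.tmul a x

theorem weightFunctional_h (φ : ℤ → k) (a : k[T;T⁻¹]) :
    weightFunctional φ (loopElt (h k) a) = laurentAction k a φ 0 := by
  rw [weightFunctional_loopElt]; simp [h]

theorem weightFunctional_e (φ : ℤ → k) (a : k[T;T⁻¹]) :
    weightFunctional φ (loopElt (e k) a) = 0 := by
  rw [weightFunctional_loopElt]; simp [e]

/-- The one-dimensional `(𝔥̂ + 𝔤̂₊)`-module attached to `φ`, as a character: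
`h ⊗ a` acts by `(a · φ)(0)` and `e ⊗ a` acts by `0`. -/
def weightCharacter (φ : ℤ → k) : LieAlgebra.LieCharacter k (borel k) :=
  letI : LieRing k := LieRing.ofAssociativeRing
  { toLinearMap := weightFunctional φ ∘ₗ (borel k).toSubmodule.subtype
    map_lie' := fun {x y} => by
      obtain ⟨x, hx⟩ := x
      obtain ⟨y, hy⟩ := y
      obtain ⟨_, ⟨a, rfl⟩, _, ⟨b, rfl⟩, rfl⟩ := Submodule.mem_sup.1 hx
      obtain ⟨_, ⟨c, rfl⟩, _, ⟨d, rfl⟩, rfl⟩ := Submodule.mem_sup.1 hy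
      change weightFunctional φ ⁅loopElt (h k) a + loopElt (e k) b,
        loopElt (h k) c + loopElt (e k) d⁆ = _
      rw [lie_borel, weightFunctional_e, LieRing.of_associative_ring_bracket, mul_comm,
        sub_self] }

/-- The induced `𝔤̂`-module of highest weight `φ`. -/
abbrev Verma (φ : ℤ → k) : Type _ := Induced (borel k) (weightCharacter φ)

/-- The irreducible highest-weight `𝔤̂`-module `L(φ)`: the irreducible quotient of the induced
module, by its largest proper submodule. -/
abbrev Irred (φ : ℤ → k) : Type _ := Verma φ ⧸ sumProper k (LoopSL2 k) (Verma φ)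

end Loop

end ExpPolyLoop

end

/-! Let `c₁`, `c₂` be the characteristic polynomials; Bézout gives `u * c₁ + w * c₂ = 1`. If `c`
annihilates `φ`, then `𝔤 ⊗ c k[t, t⁻¹]` acts by zero on an irreducible module of highest weight `φ`
(`lie_eq_zero`): the vectors `(f ⊗ cb) v` are killed by `e ⊗ k[t, t⁻¹]`, so they generate a
submodule strictly below `v`, which must vanish. Hence `x ⊗ w c₂ b` acts on `L(φ₁) ⊗ L(φ₂)` as `x ⊗
b` on the first factor alone, and every submodule of the tensor product is stable under the action
on each factor separately (`rTensor_mem`, `lTensor_mem`). The tensor product is then irreducible in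
the manner of an outer tensor product: contraction and projection to the highest weight turn a
nonzero vector of a submodule into some `v₁ ⊗ n` with `n ≠ 0` (`isIrreducibleHighestWeight_tmul`).
Its generator `v₁ ⊗ v₂` has weight `φ₁ + φ₂`, and an irreducible highest-weight module is determined
by its weight (`nonempty_irred_equiv`).

Weight decompositions are replaced by polynomials in the single operator `h ⊗ 1`, which acts by `φ 0
- 2n` after `n` applications of elements of `f ⊗ k[t, t⁻¹]`; in characteristic zero these scalars
are distinct. That the induced module is nonzero, usually read off from the PBW theorem, is shown by
an explicit action on a polynomial ring (`vermaGen_ne_zero`). -/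

noncomputable section

namespace ExpPolyLoop

/-! ### Brackets of `e`, `h`, `f` and spanning sets of the loop algebra. -/

section SL2Relations

variable (k : Type*) [Field k]

/-- The standard basis vector `f`. -/
def f : SL2 k := ⟨!![0, 0; 1, 0], by
  simp [LieAlgebra.SpecialLinear.sl, Matrix.trace_fin_two]⟩

theorem lie_e_f : ⁅e k, f k⁆ = h k := by
  apply Subtype.ext
  rw [LieAlgebra.SpecialLinear.sl_bracket]
  ext i j
  fin_cases i <;> fin_cases j <;> norm_num [h, e, f, Matrix.mul_apply]

theorem lie_h_f : ⁅h k, f k⁆ = (-2 : k) • f k := by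
  apply Subtype.ext
  rw [LieAlgebra.SpecialLinear.sl_bracket]
  ext i j
  fin_cases i <;> fin_cases j <;> norm_num [h, f, Matrix.mul_apply]

variable {k}

theorem sl2_eq (x : SL2 k) :
    x = (x : Matrix (Fin 2) (Fin 2) k) 0 0 • h k + (x : Matrix (Fin 2) (Fin 2) k) 0 1 • e k +
      (x : Matrix (Fin 2) (Fin 2) k) 1 0 • f k := by
  have hx : (x : Matrix (Fin 2) (Fin 2) k).trace = 0 := x.2
  rw [Matrix.trace_fin_two] at hx
  apply Subtype.ext
  ext i j
  fin_cases i <;> fin_cases j <;> simp [h, e, f]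
  exact eq_neg_of_add_eq_zero_right hx

theorem loopElt_smul (c : k) (x : SL2 k) (a : k[T;T⁻¹]) :
    loopElt (c • x) a = loopElt x (c • a) :=
  (TensorProduct.smul_tmul c a x).symm

theorem loopElt_add (x y : SL2 k) (a : k[T;T⁻¹]) :
    loopElt (x + y) a = loopElt x a + loopElt y a :=
  TensorProduct.tmul_add a x y

/-- The loop algebra is spanned by the elements `x ⊗ a`. -/
theorem loop_induction {p : LoopSL2 k → Prop} (z : LoopSL2 k)
    (elt : ∀ x a, p (loopElt x a)) (add : ∀ y z, p y → p z → p (y + z)) : p z := by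
  induction z using TensorProduct.induction_on with
  | zero =>
    have h0 := elt 0 0
    rwa [map_zero] at h0
  | tmul a x => exact elt x a
  | add y z hy hz => exact add y z hy hz

theorem loop_induction_basis {p : LoopSL2 k → Prop} (z : LoopSL2 k)
    (he : ∀ a, p (loopElt (e k) a)) (hh : ∀ a, p (loopElt (h k) a))
    (hf : ∀ a, p (loopElt (f k) a)) (add : ∀ y z, p y → p z → p (y + z)) : p z := by
  induction z using loop_induction with
  | elt x a =>
    rw [sl2_eq x, loopElt_add, loopElt_add, loopElt_smul, loopElt_smul, loopElt_smul]
    exact add _ _ (add _ _ (hh _) (he _)) (hf _)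
  | add y z hy hz => exact add y z hy hz

end SL2Relations

/-! ### Submodules generated by Borel-stable subspaces. -/

section Layers

variable {k : Type*} [Field k] {M : Type*} [AddCommGroup M] [Module k M]
  [LieRingModule (LoopSL2 k) M] [LieModule k (LoopSL2 k) M]

omit [Module k M] [LieModule k (LoopSL2 k) M] in
theorem e_lie_f_lie (a b : k[T;T⁻¹]) (m : M) :
    ⁅loopElt (e k) a, ⁅loopElt (f k) b, m⁆⁆ =
      ⁅loopElt (h k) (a * b), m⁆ + ⁅loopElt (f k) b, ⁅loopElt (e k) a, m⁆⁆ := by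
  rw [leibniz_lie, lie_loopElt, lie_e_f]

theorem h_lie_f_lie (a b : k[T;T⁻¹]) (m : M) :
    ⁅loopElt (h k) a, ⁅loopElt (f k) b, m⁆⁆ =
      (-2 : k) • ⁅loopElt (f k) (a * b), m⁆ + ⁅loopElt (f k) b, ⁅loopElt (h k) a, m⁆⁆ := by
  rw [leibniz_lie, lie_loopElt, lie_h_f, loopElt_smul, map_smul, smul_lie]

/-- The span of the vectors obtained from `K` by applying `n` elements of `f ⊗ k[t, t⁻¹]`. -/
def layer (K : Submodule k M) : ℕ → Submodule k M
  | 0 => K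
  | n + 1 => ⨆ a, (layer K n).map (LieModule.toEnd k (LoopSL2 k) M (loopElt (f k) a))

theorem layer_succ_le {K S : Submodule k M} {n : ℕ} :
    layer K (n + 1) ≤ S ↔ ∀ a, ∀ w ∈ layer K n, ⁅loopElt (f k) a, w⁆ ∈ S := by
  rw [layer, iSup_le_iff]
  refine forall_congr' fun a => ?_
  rw [Submodule.map_le_iff_le_comap]
  rfl

theorem f_lie_mem_layer {K : Submodule k M} {n : ℕ} (a : k[T;T⁻¹]) {w : M}
    (hw : w ∈ layer K n) : ⁅loopElt (f k) a, w⁆ ∈ layer K (n + 1) :=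
  layer_succ_le.1 le_rfl a w hw

theorem layer_le_layer_add {K S : Submodule k M} {r : ℕ} (hK : K ≤ layer S r) (n : ℕ) :
    layer K n ≤ layer S (n + r) := by
  induction n with
  | zero => simpa [layer] using hK
  | succ n ih =>
    rw [layer_succ_le]
    intro a w hw
    rw [Nat.add_right_comm]
    exact f_lie_mem_layer a (ih hw)

/-- The subspace `K` is stable under `h ⊗ k[t, t⁻¹]` and killed by `e ⊗ k[t, t⁻¹]`. -/
structure IsBorelStable (K : Submodule k M) : Prop where
  h_mem : ∀ a, ∀ m ∈ K, ⁅loopElt (h k) a, m⁆ ∈ K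
  e_eq_zero : ∀ a, ∀ m ∈ K, ⁅loopElt (e k) a, m⁆ = 0

namespace IsBorelStable

variable {K : Submodule k M} (hK : IsBorelStable K)
include hK

theorem h_lie_mem_layer (n : ℕ) : ∀ a, ∀ m ∈ layer K n, ⁅loopElt (h k) a, m⁆ ∈ layer K n := by
  induction n with
  | zero => exact hK.h_mem
  | succ n ih =>
    intro a
    refine (layer_succ_le (S := (layer K (n + 1)).comap
      (LieModule.toEnd k (LoopSL2 k) M (loopElt (h k) a)))).2 fun b w hw => ?_
    change ⁅loopElt (h k) a, ⁅loopElt (f k) b, w⁆⁆ ∈ layer K (n + 1)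
    rw [h_lie_f_lie]
    exact add_mem (Submodule.smul_mem _ _ (f_lie_mem_layer _ hw)) (f_lie_mem_layer _ (ih a w hw))

/-- Moving `e ⊗ a` past `f ⊗ b` costs `h ⊗ ab`, which preserves layers, so `e ⊗ a` undoes exactly
one application of `f`. -/
theorem e_lie_mem_layer (n : ℕ) :
    ∀ a, ∀ m ∈ layer K (n + 1), ⁅loopElt (e k) a, m⁆ ∈ layer K n := by
  induction n with
  | zero =>
    intro a
    refine (layer_succ_le (S := (layer K 0).comap
      (LieModule.toEnd k (LoopSL2 k) M (loopElt (e k) a)))).2 fun b w hw => ?_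
    change ⁅loopElt (e k) a, ⁅loopElt (f k) b, w⁆⁆ ∈ layer K 0
    rw [e_lie_f_lie, hK.e_eq_zero a w hw, lie_zero, add_zero]
    exact hK.h_mem _ _ hw
  | succ n ih =>
    intro a
    refine (layer_succ_le (S := (layer K (n + 1)).comap
      (LieModule.toEnd k (LoopSL2 k) M (loopElt (e k) a)))).2 fun b w hw => ?_
    change ⁅loopElt (e k) a, ⁅loopElt (f k) b, w⁆⁆ ∈ layer K (n + 1)
    rw [e_lie_f_lie]
    exact add_mem (hK.h_lie_mem_layer _ _ _ hw) (f_lie_mem_layer _ (ih a w hw))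

theorem lie_mem_iSup_layer (x : LoopSL2 k) {m : M} (hm : m ∈ ⨆ n, layer K n) :
    ⁅x, m⁆ ∈ ⨆ n, layer K n := by
  suffices (⨆ n, layer K n) ≤ (⨆ n, layer K n).comap (LieModule.toEnd k (LoopSL2 k) M x) from
    this hm
  have le (n : ℕ) : layer K n ≤ ⨆ n, layer K n := le_iSup _ n
  refine iSup_le fun n w hw => ?_
  change ⁅x, w⁆ ∈ ⨆ n, layer K n
  induction x using loop_induction_basis with
  | he a =>
    cases n with
    | zero => rw [hK.e_eq_zero a w hw]; exact zero_mem _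
    | succ n => exact le n (hK.e_lie_mem_layer n a w hw)
  | hh a => exact le n (hK.h_lie_mem_layer n a w hw)
  | hf a => exact le (n + 1) (f_lie_mem_layer a hw)
  | add y z hy hz => rw [add_lie]; exact add_mem hy hz

/-- The Lie submodule generated by a Borel-stable subspace, as a sum of layers. -/
def generated : LieSubmodule k (LoopSL2 k) M where
  toSubmodule := ⨆ n, layer K n
  lie_mem := hK.lie_mem_iSup_layer _

theorem le_generated {m : M} (hm : m ∈ K) : m ∈ hK.generated :=
  le_iSup (layer K) 0 hm

end IsBorelStable

end Layers

/-! ### Highest-weight modules and the annihilation of `𝔤 ⊗ c k[t, t⁻¹]`. -/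

section HighestWeight

variable {k : Type*} [Field k] {M : Type*} [AddCommGroup M] [Module k M]
  [LieRingModule (LoopSL2 k) M] [LieModule k (LoopSL2 k) M]

/-- The vector `v` is a highest-weight vector of weight `φ` generating the module. -/
structure IsHighestWeight (φ : ℤ → k) (v : M) : Prop where
  h_lie : ∀ a, ⁅loopElt (h k) a, v⁆ = laurentAction k a φ 0 • v
  e_lie : ∀ a, ⁅loopElt (e k) a, v⁆ = 0
  eq_top : ∀ N : LieSubmodule k (LoopSL2 k) M, v ∈ N → N = ⊤

/-- The sum of all the lower layers below the vector `v`. -/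
def lower (v : M) : Submodule k M := ⨆ n, layer (k ∙ v) (n + 1)

namespace IsHighestWeight

variable {φ : ℤ → k} {v : M} (hv : IsHighestWeight φ v)
include hv

theorem isBorelStable : IsBorelStable (k ∙ v) where
  h_mem a m hm := by
    obtain ⟨c, rfl⟩ := Submodule.mem_span_singleton.1 hm
    rw [lie_smul, hv.h_lie]
    exact Submodule.smul_mem _ _ (Submodule.smul_mem _ _ (Submodule.mem_span_singleton_self v))
  e_eq_zero a m hm := by
    obtain ⟨c, rfl⟩ := Submodule.mem_span_singleton.1 hm
    rw [lie_smul, hv.e_lie, smul_zero]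

theorem exists_eq_smul_add (m : M) : ∃ c : k, ∃ l ∈ lower (k := k) v, m = c • v + l := by
  have htop : hv.isBorelStable.generated = ⊤ :=
    hv.eq_top _ (hv.isBorelStable.le_generated (Submodule.mem_span_singleton_self v))
  have hm : m ∈ ⨆ n, layer (k ∙ v) n := by
    change m ∈ hv.isBorelStable.generated
    rw [htop]; trivial
  have hle : (⨆ n, layer (k ∙ v) n) ≤ (k ∙ v) ⊔ lower v := by
    refine iSup_le fun n => ?_
    cases n with
    | zero => exact le_sup_left
    | succ n => exact le_sup_of_le_right (le_iSup (fun n => layer (k ∙ v) (n + 1)) n)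
  obtain ⟨x, hx, l, hl, rfl⟩ := Submodule.mem_sup.1 (hle hm)
  obtain ⟨c, rfl⟩ := Submodule.mem_span_singleton.1 hx
  exact ⟨c, l, hl, rfl⟩

theorem h_one_lie_of_mem_layer (n : ℕ) :
    ∀ m ∈ layer (k ∙ v) n, ⁅loopElt (h k) 1, m⁆ = (φ 0 - 2 * n) • m := by
  induction n with
  | zero =>
    intro m hm
    obtain ⟨c, rfl⟩ := Submodule.mem_span_singleton.1 hm
    rw [lie_smul, hv.h_lie, smul_comm]
    simp
  | succ n ih =>
    intro m hm
    have hle : layer (k ∙ v) (n + 1) ≤ LinearMap.ker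
        (LieModule.toEnd k (LoopSL2 k) M (loopElt (h k) 1) -
          (φ 0 - 2 * (n + 1 : ℕ)) • LinearMap.id) := by
      rw [layer_succ_le]
      intro a w hw
      rw [LinearMap.mem_ker, LinearMap.sub_apply, LieModule.toEnd_apply_apply, h_lie_f_lie,
        ih w hw, one_mul, lie_smul, LinearMap.smul_apply, LinearMap.id_apply, ← add_smul,
        ← sub_smul]
      push_cast
      ring_nf
      simp
    exact sub_eq_zero.1 (hle hm)

variable [CharZero k]

/-- Any vector of the lower part is killed by a polynomial in `h ⊗ 1` whose value at the
highest weight is `1`. -/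
theorem exists_aeval_eq_zero {l : M} (hl : l ∈ lower (k := k) v) :
    ∃ q : Polynomial k, q.eval (φ 0) = 1 ∧
      Polynomial.aeval (LieModule.toEnd k (LoopSL2 k) M (loopElt (h k) 1)) q l = 0 := by
  induction hl using Submodule.iSup_induction' with
  | mem n x hx =>
    have h2 : (2 * ((n + 1 : ℕ) : k)) ≠ 0 :=
      mul_ne_zero two_ne_zero (Nat.cast_ne_zero.2 n.succ_ne_zero)
    -- The linear polynomial vanishing at the eigenvalue `φ 0 - 2(n + 1)` of this layer, normalised
    -- at `φ 0`; the division by `2(n + 1)` needs characteristic zero.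
    refine ⟨Polynomial.C (2 * ((n + 1 : ℕ) : k))⁻¹ *
      (Polynomial.X - Polynomial.C (φ 0 - 2 * ((n + 1 : ℕ) : k))), ?_, ?_⟩
    · simp only [Polynomial.eval_mul, Polynomial.eval_C, Polynomial.eval_sub, Polynomial.eval_X,
        sub_sub_cancel]
      exact inv_mul_cancel₀ h2
    · rw [map_mul, Module.End.mul_apply, map_sub, Polynomial.aeval_X, Polynomial.aeval_C,
        Polynomial.aeval_C, LinearMap.sub_apply, LieModule.toEnd_apply_apply,
        hv.h_one_lie_of_mem_layer _ x hx,
        Module.algebraMap_end_apply, Module.algebraMap_end_apply, sub_self, smul_zero]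
  | zero => exact ⟨1, by simp, by simp⟩
  | add x y _ _ ihx ihy =>
    obtain ⟨q, hq, hqx⟩ := ihx
    obtain ⟨r, hr, hry⟩ := ihy
    -- Polynomials in one operator commute, so each summand can meet its own annihilating factor
    -- first.
    refine ⟨q * r, by rw [Polynomial.eval_mul, hq, hr, one_mul], ?_⟩
    rw [map_add]
    nth_rw 1 [mul_comm q r]
    rw [map_mul, map_mul, Module.End.mul_apply, Module.End.mul_apply, hqx, hry, map_zero,
      map_zero, add_zero]

omit [CharZero k] in
theorem aeval_self (q : Polynomial k) :
    Polynomial.aeval (LieModule.toEnd k (LoopSL2 k) M (loopElt (h k) 1)) q v =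
      q.eval (φ 0) • v := by
  refine Module.End.aeval_apply_of_mem_apply_eq_smul ?_
  rw [LieModule.toEnd_apply_apply, hv.h_lie, map_one]
  rfl

theorem notMem_lower (h0 : v ≠ 0) : v ∉ lower (k := k) v := by
  intro hl
  obtain ⟨q, hq, hqv⟩ := hv.exists_aeval_eq_zero hl
  rw [hv.aeval_self, hq, one_smul] at hqv
  exact h0 hqv

/-- A polynomial in `h ⊗ 1` extracts the component `c • v` of a vector of `N` without leaving `N`;
if `c ≠ 0`, then `N` contains the generator. -/
theorem le_lower {N : LieSubmodule k (LoopSL2 k) M} (hN : N ≠ ⊤) : N.toSubmodule ≤ lower v := by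
  intro m hm
  obtain ⟨c, l, hl, rfl⟩ := hv.exists_eq_smul_add m
  obtain ⟨q, hq, hql⟩ := hv.exists_aeval_eq_zero hl
  have hmem : ∀ x ∈ N, Polynomial.aeval
      (LieModule.toEnd k (LoopSL2 k) M (loopElt (h k) 1)) q x ∈ N := fun x hx =>
    Polynomial.aeval_apply_smul_mem_of_le_comap (q := N.toSubmodule) hx q _
      fun y hy => N.lie_mem hy
  have hc : c • v ∈ N := by
    have := hmem _ hm
    rwa [map_add, map_smul, hv.aeval_self, hq, hql, one_smul, add_zero] at this
  by_cases h0 : c = 0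
  · rwa [h0, zero_smul, zero_add]
  · refine absurd (hv.eq_top N ?_) hN
    simpa [smul_smul, h0] using N.smul_mem c⁻¹ hc

end IsHighestWeight

/-- The vector `v` is a generating highest-weight vector of an irreducible module. -/
structure IsIrreducibleHighestWeight (φ : ℤ → k) (v : M) : Prop extends
    IsHighestWeight φ v where
  ne_zero : v ≠ 0
  eq_bot : ∀ N : LieSubmodule k (LoopSL2 k) M, N ≠ ⊤ → N = ⊥

namespace IsIrreducibleHighestWeight

variable {φ : ℤ → k} {v : M} (hv : IsIrreducibleHighestWeight φ v)
include hv

omit [LieModule k (LoopSL2 k) M] in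
theorem mem_of_ne_zero {N : LieSubmodule k (LoopSL2 k) M} {m : M} (hm : m ∈ N) (h0 : m ≠ 0)
    (x : M) : x ∈ N := by
  have : N = ⊤ := by
    by_contra hN
    rw [hv.eq_bot N hN] at hm
    exact h0 ((LieSubmodule.mem_bot m).1 hm)
  rw [this]; trivial

variable [CharZero k]

/-- If `c` annihilates `φ`, then `𝔤 ⊗ c k[t, t⁻¹]` kills the irreducible module of highest
weight `φ`. -/
theorem lie_eq_zero {c : k[T;T⁻¹]} (hc : laurentAction k c φ = 0) (x : SL2 k) (b : k[T;T⁻¹])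
    (m : M) : ⁅loopElt x (c * b), m⁆ = 0 := by
  have hcb : ∀ b, laurentAction k (c * b) φ 0 = 0 := fun b => by
    rw [mul_comm, map_mul, Module.End.mul_apply, hc, map_zero]; rfl
  let F : k[T;T⁻¹] →ₗ[k] M :=
    { toFun := fun b => ⁅loopElt (f k) (c * b), v⁆
      map_add' := fun a b => by rw [mul_add, map_add, add_lie]
      map_smul' := fun r b => by rw [mul_smul_comm, map_smul, smul_lie]; rfl }
  -- On these vectors `e ⊗ a` gives `(h ⊗ acb) v`, whose scalar `(acb · φ)(0)` is zero because `c ·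
  -- φ = 0`.
  have hF : IsBorelStable (LinearMap.range F) :=
    { h_mem := by
        rintro a _ ⟨b, rfl⟩
        change ⁅loopElt (h k) a, ⁅loopElt (f k) (c * b), v⁆⁆ ∈ _
        rw [h_lie_f_lie, hv.h_lie, lie_smul, mul_left_comm]
        exact add_mem (Submodule.smul_mem _ _ ⟨a * b, rfl⟩) (Submodule.smul_mem _ _ ⟨b, rfl⟩)
      e_eq_zero := by
        rintro a _ ⟨b, rfl⟩
        change ⁅loopElt (e k) a, ⁅loopElt (f k) (c * b), v⁆⁆ = 0
        rw [e_lie_f_lie, hv.h_lie, hv.e_lie, mul_left_comm, hcb, zero_smul, lie_zero, add_zero] }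
  have hle : LinearMap.range F ≤ layer (k ∙ v) 1 := by
    rintro _ ⟨b, rfl⟩
    exact f_lie_mem_layer (n := 0) _ (Submodule.mem_span_singleton_self v)
  -- The generated submodule starts one layer below `v`, so it misses `v`, is proper, and vanishes
  -- by irreducibility.
  have hlow : hF.generated.toSubmodule ≤ lower v := iSup_le fun n =>
    (layer_le_layer_add hle n).trans (le_iSup (fun n => layer (k ∙ v) (n + 1)) n)
  have hbot : hF.generated = ⊥ := hv.eq_bot _ fun htop =>
    hv.notMem_lower hv.ne_zero (hlow (by rw [htop]; trivial))
  have hfv : ∀ b, ⁅loopElt (f k) (c * b), v⁆ = 0 := fun b => by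
    have := hF.le_generated (m := F b) ⟨b, rfl⟩
    rw [hbot] at this
    exact (LieSubmodule.mem_bot _).1 this
  have hxv : ∀ x b, ⁅loopElt x (c * b), v⁆ = 0 := fun x b => by
    rw [sl2_eq x, loopElt_add, loopElt_add, loopElt_smul, loopElt_smul, loopElt_smul, add_lie,
      add_lie, ← mul_smul_comm, ← mul_smul_comm, ← mul_smul_comm, hfv, hv.e_lie, hv.h_lie, hcb]
    simp
  -- Since `𝔤 ⊗ c k[t, t⁻¹]` is an ideal, the vectors it kills form a submodule; this one contains
  -- the generator `v`.
  let N : LieSubmodule k (LoopSL2 k) M :=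
    { carrier := {m | ∀ x b, ⁅loopElt x (c * b), m⁆ = 0}
      add_mem' := fun {m n} hm hn x b => by rw [lie_add, hm, hn, add_zero]
      zero_mem' := fun x b => lie_zero _
      smul_mem' := fun r m hm x b => by rw [lie_smul, hm, smul_zero]
      lie_mem := fun {y m} hm x b => by
        induction y using loop_induction with
        | elt y a =>
          rw [leibniz_lie, lie_loopElt, hm x b, mul_assoc]
          change ⁅loopElt ⁅x, y⁆ (c * (b * a)), m⁆ + _ = 0
          rw [hm, lie_zero, add_zero]
        | add y z hy hz =>
          rw [add_lie, lie_add, hy, hz, add_zero] }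
  have hN : N = ⊤ := hv.eq_top N hxv
  have hm : m ∈ N := by rw [hN]; trivial
  exact hm x b

end IsIrreducibleHighestWeight

end HighestWeight

/-! ### Contractions of tensors along functionals. -/

section TensorSlices

variable {k : Type*} [Field k] {M N : Type*} [AddCommGroup M] [Module k M]
  [AddCommGroup N] [Module k N]

/-- A nonzero tensor has a nonzero slice along some functional on the right factor. -/
theorem exists_rid_lTensor_ne_zero {z : M ⊗[k] N} (hz : z ≠ 0) :
    ∃ ξ : N →ₗ[k] k, TensorProduct.rid k M (ξ.lTensor M z) ≠ 0 := by
  classical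
  by_contra! H
  let b := Module.Basis.ofVectorSpace k N
  refine hz ((TensorProduct.equivFinsuppOfBasisRight (M := M) b).injective ?_)
  rw [map_zero]
  ext i
  rw [TensorProduct.equivFinsuppOfBasisRight_apply, H]
  rfl

/-- Contracting the right factor commutes with operators on the left one, so submodules stable under
the left action contract to submodules. -/
theorem rid_lTensor_rTensor (T : Module.End k M) (ξ : N →ₗ[k] k) (z : M ⊗[k] N) :
    TensorProduct.rid k M (ξ.lTensor M (T.rTensor N z)) =
      T (TensorProduct.rid k M (ξ.lTensor M z)) := by
  induction z with
  | zero => simp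
  | tmul m n => simp
  | add y z hy hz => simp only [map_add, hy, hz]

theorem apply_lid_rTensor (π : M →ₗ[k] k) (ξ : N →ₗ[k] k) (z : M ⊗[k] N) :
    ξ (TensorProduct.lid k N (π.rTensor N z)) =
      π (TensorProduct.rid k M (ξ.lTensor M z)) := by
  induction z with
  | zero => simp
  | tmul m n => simp [mul_comm]
  | add y z hy hz => simp only [map_add, hy, hz]

end TensorSlices

/-! ### Irreducibility of the tensor product under separated actions. -/

section Tensor

variable {k : Type*} [Field k]
  {M₁ : Type*} [AddCommGroup M₁] [Module k M₁] [LieRingModule (LoopSL2 k) M₁]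
  [LieModule k (LoopSL2 k) M₁]
  {M₂ : Type*} [AddCommGroup M₂] [Module k M₂] [LieRingModule (LoopSL2 k) M₂]
  [LieModule k (LoopSL2 k) M₂]

theorem lie_eq_rTensor_add_lTensor (x : LoopSL2 k) (z : M₁ ⊗[k] M₂) :
    ⁅x, z⁆ = (LieModule.toEnd k (LoopSL2 k) M₁ x).rTensor M₂ z +
      (LieModule.toEnd k (LoopSL2 k) M₂ x).lTensor M₁ z := by
  induction z with
  | zero => simp
  | tmul m n => simp
  | add y z hy hz => rw [lie_add, hy, hz, map_add, map_add]; abel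

/-- Two complementary Laurent polynomials separate the actions of the loop algebra on the two
modules. -/
structure IsSeparating (p₁ p₂ : k[T;T⁻¹]) (M₁ M₂ : Type*) [AddCommGroup M₁]
    [LieRingModule (LoopSL2 k) M₁] [AddCommGroup M₂] [LieRingModule (LoopSL2 k) M₂] : Prop where
  add_eq_one : p₁ + p₂ = 1
  left : ∀ (x : SL2 k) (b : k[T;T⁻¹]) (m : M₁), ⁅loopElt x (p₁ * b), m⁆ = 0
  right : ∀ (x : SL2 k) (b : k[T;T⁻¹]) (m : M₂), ⁅loopElt x (p₂ * b), m⁆ = 0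

namespace IsSeparating

variable {p₁ p₂ : k[T;T⁻¹]} (hp : IsSeparating p₁ p₂ M₁ M₂)
  (N : LieSubmodule k (LoopSL2 k) (M₁ ⊗[k] M₂))
include hp

omit [Module k M₁] [LieModule k (LoopSL2 k) M₁] [Module k M₂] [LieModule k (LoopSL2 k) M₂]
  in
theorem left_complement (x : SL2 k) (b : k[T;T⁻¹]) (m : M₁) :
    ⁅loopElt x (p₂ * b), m⁆ = ⁅loopElt x b, m⁆ := by
  rw [← zero_add ⁅_, m⁆, ← hp.left x b m, ← add_lie, ← map_add, ← add_mul, hp.add_eq_one, one_mul]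

/-- The element `x ⊗ p₂ b` acts as `x ⊗ b` on `M₁` and as zero on `M₂`, so the diagonal action
already contains the action on the first factor. -/
theorem rTensor_mem (y : LoopSL2 k) {z : M₁ ⊗[k] M₂} (hz : z ∈ N) :
    (LieModule.toEnd k (LoopSL2 k) M₁ y).rTensor M₂ z ∈ N := by
  induction y using loop_induction with
  | elt x b =>
    have h1 : LieModule.toEnd k (LoopSL2 k) M₁ (loopElt x (p₂ * b)) =
        LieModule.toEnd k (LoopSL2 k) M₁ (loopElt x b) :=
      LinearMap.ext fun m => hp.left_complement x b m
    have h2 : LieModule.toEnd k (LoopSL2 k) M₂ (loopElt x (p₂ * b)) = 0 :=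
      LinearMap.ext fun m => hp.right x b m
    have := N.lie_mem (x := loopElt x (p₂ * b)) hz
    rwa [lie_eq_rTensor_add_lTensor, h1, h2, LinearMap.lTensor_zero, LinearMap.zero_apply,
      add_zero] at this
  | add y w hy hw =>
    rw [map_add, LinearMap.rTensor_add]
    exact add_mem hy hw

theorem lTensor_mem (y : LoopSL2 k) {z : M₁ ⊗[k] M₂} (hz : z ∈ N) :
    (LieModule.toEnd k (LoopSL2 k) M₂ y).lTensor M₁ z ∈ N := by
  have := sub_mem (N.lie_mem (x := y) hz) (hp.rTensor_mem N y hz)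
  rwa [lie_eq_rTensor_add_lTensor, add_sub_cancel_left] at this

/-- The vectors `m` with `m ⊗ n ∈ N`, for a fixed `n`. -/
def leftSlice (n : M₂) : LieSubmodule k (LoopSL2 k) M₁ where
  toSubmodule := N.toSubmodule.comap ((TensorProduct.mk k M₁ M₂).flip n)
  lie_mem {y m} hm := by
    simpa using hp.rTensor_mem N y (z := m ⊗ₜ n) hm

/-- The vectors `n` with `m ⊗ n ∈ N`, for a fixed `m`. -/
def rightSlice (m : M₁) : LieSubmodule k (LoopSL2 k) M₂ where
  toSubmodule := N.toSubmodule.comap (TensorProduct.mk k M₁ M₂ m)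
  lie_mem {y n} hn := by
    simpa using hp.lTensor_mem N y (z := m ⊗ₜ n) hn

variable {φ₁ φ₂ : ℤ → k} {v₁ : M₁} {v₂ : M₂}

theorem isHighestWeight_tmul (hv₁ : IsHighestWeight φ₁ v₁) (hv₂ : IsHighestWeight φ₂ v₂) :
    IsHighestWeight (φ₁ + φ₂) (v₁ ⊗ₜ[k] v₂) where
  h_lie a := by
    rw [TensorProduct.LieModule.lie_tmul_right, hv₁.h_lie, hv₂.h_lie, TensorProduct.tmul_smul,
      ← TensorProduct.smul_tmul', ← add_smul, map_add]
    rfl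
  e_lie a := by
    rw [TensorProduct.LieModule.lie_tmul_right, hv₁.e_lie, hv₂.e_lie, TensorProduct.tmul_zero,
      TensorProduct.zero_tmul, add_zero]
  eq_top N hN := by
    have h1 : hp.leftSlice N v₂ = ⊤ := hv₁.eq_top _ hN
    have h2 (m : M₁) : hp.rightSlice N m = ⊤ := hv₂.eq_top _ <| by
      change m ∈ hp.leftSlice N v₂
      rw [h1]; trivial
    rw [eq_top_iff]
    rintro z -
    induction z with
    | zero => exact zero_mem _
    | tmul m n =>
      change n ∈ hp.rightSlice N m
      rw [h2]; trivial
    | add y z hy hz => exact add_mem hy hz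

variable [CharZero k]

-- A polynomial in `h ⊗ 1` on the left factor acts on a given `z` as the projection onto `v₁ ⊗ M₂`
-- along `lower v₁ ⊗ M₂`; being a polynomial, it preserves stable subspaces.
omit [LieRingModule (LoopSL2 k) M₂] [LieModule k (LoopSL2 k) M₂] hp in
theorem _root_.ExpPolyLoop.IsHighestWeight.exists_aeval_rTensor (hv₁ : IsHighestWeight φ₁ v₁)
    {π : M₁ →ₗ[k] k} (hπ : π v₁ = 1) (hlow : ∀ l ∈ lower (k := k) v₁, π l = 0)
    (z : M₁ ⊗[k] M₂) :
    ∃ q : Polynomial k, q.eval (φ₁ 0) = 1 ∧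
      (Polynomial.aeval (LieModule.toEnd k (LoopSL2 k) M₁ (loopElt (h k) 1)) q).rTensor M₂ z =
        v₁ ⊗ₜ TensorProduct.lid k M₂ (π.rTensor M₂ z) := by
  induction z with
  | zero => exact ⟨1, by simp, by simp⟩
  | tmul m n =>
    obtain ⟨c, l, hl, rfl⟩ := hv₁.exists_eq_smul_add m
    obtain ⟨q, hq, hql⟩ := hv₁.exists_aeval_eq_zero hl
    refine ⟨q, hq, ?_⟩
    rw [LinearMap.rTensor_tmul, LinearMap.rTensor_tmul, TensorProduct.lid_tmul, map_add, map_add,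
      map_smul, map_smul, hql, hlow l hl, hv₁.aeval_self, hq, hπ, one_smul, add_zero, add_zero,
      smul_eq_mul, mul_one, TensorProduct.smul_tmul]
  | add y z ihy ihz =>
    obtain ⟨q, hq, hqy⟩ := ihy
    obtain ⟨r, hr, hrz⟩ := ihz
    refine ⟨q * r, by rw [Polynomial.eval_mul, hq, hr, one_mul], ?_⟩
    rw [map_add]
    nth_rw 1 [mul_comm q r]
    rw [map_mul, map_mul, LinearMap.rTensor_mul, LinearMap.rTensor_mul, Module.End.mul_apply,
      Module.End.mul_apply, hqy, hrz, LinearMap.rTensor_tmul, LinearMap.rTensor_tmul,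
      hv₁.aeval_self, hv₁.aeval_self, hq, hr, one_smul, ← TensorProduct.tmul_add,
      ← map_add, ← map_add]

theorem isIrreducibleHighestWeight_tmul (hv₁ : IsIrreducibleHighestWeight φ₁ v₁)
    (hv₂ : IsIrreducibleHighestWeight φ₂ v₂) :
    IsIrreducibleHighestWeight (φ₁ + φ₂) (v₁ ⊗ₜ[k] v₂) where
  toIsHighestWeight := hp.isHighestWeight_tmul hv₁.toIsHighestWeight hv₂.toIsHighestWeight
  ne_zero := by
    intro h0
    refine hv₂.ne_zero ((Module.forall_dual_apply_eq_zero_iff k v₂).1 fun ξ => ?_)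
    have := congr(TensorProduct.rid k M₁ (ξ.lTensor M₁ $h0))
    rw [LinearMap.lTensor_tmul, TensorProduct.rid_tmul, map_zero, map_zero] at this
    exact (smul_eq_zero.1 this).resolve_right hv₁.ne_zero
  eq_bot N hN := by
    by_contra hbot
    obtain ⟨z, hz, hz0⟩ := (Submodule.ne_bot_iff N.toSubmodule).1
      (mt (LieSubmodule.toSubmodule_eq_bot N).1 hbot)
    obtain ⟨ξ, hξ⟩ := exists_rid_lTensor_ne_zero hz0
    -- The contraction of `N` along `ξ` is a nonzero submodule of the irreducible `M₁`, so some `n ∈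
    -- N` contracts to `v₁`.
    let S : LieSubmodule k (LoopSL2 k) M₁ :=
      { toSubmodule := N.toSubmodule.map
          ((TensorProduct.rid k M₁).toLinearMap ∘ₗ ξ.lTensor M₁)
        lie_mem := by
          rintro y _ ⟨n, hn, rfl⟩
          exact ⟨_, hp.rTensor_mem N y hn, rid_lTensor_rTensor _ ξ n⟩ }
    obtain ⟨n, hn, hnv⟩ : v₁ ∈ S := hv₁.mem_of_ne_zero (N := S) ⟨z, hz, rfl⟩ hξ v₁
    obtain ⟨π, hlow, hπ⟩ := LinearMap.exists_extend_of_notMem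
      (0 : lower (k := k) v₁ →ₗ[k] k) (hv₁.notMem_lower hv₁.ne_zero) 1
    obtain ⟨q, -, hqn⟩ := hv₁.exists_aeval_rTensor hπ (fun l hl => congr($hlow ⟨l, hl⟩)) n
    have hqN : (Polynomial.aeval
        (LieModule.toEnd k (LoopSL2 k) M₁ (loopElt (h k) 1)) q).rTensor M₂ n ∈ N := by
      have := Polynomial.aeval_apply_smul_mem_of_le_comap (q := N.toSubmodule) hn q
        (Module.End.rTensorAlgHom k M₁ M₂ (LieModule.toEnd k (LoopSL2 k) M₁ (loopElt (h k) 1)))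
        fun y hy => hp.rTensor_mem N _ hy
      rwa [Polynomial.aeval_algHom_apply] at this
    rw [hqn] at hqN
    -- Applying `ξ` to this vector amounts to contracting `n` along `ξ` and then applying `π`, which
    -- gives `π v₁ = 1`.
    have hne : TensorProduct.lid k M₂ (π.rTensor M₂ n) ≠ 0 := by
      intro h0
      have := apply_lid_rTensor π ξ n
      rw [h0, map_zero] at this
      refine one_ne_zero (α := k) ?_
      rw [this, ← hπ, ← hnv]
      rfl
    have hmem : v₂ ∈ hp.rightSlice N v₁ := hv₂.mem_of_ne_zero hqN hne v₂
    exact hN ((hp.isHighestWeight_tmul hv₁.toIsHighestWeight hv₂.toIsHighestWeight).eq_top N hmem)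

end IsSeparating

end Tensor

/-! ### The universal property of the induced module. -/

section InducedModule

attribute [local instance 100] LieRing.ofAssociativeRing

variable {k L : Type*} [Field k] [LieRing L] [LieAlgebra k L]

theorem universalEnveloping_induction {C : UniversalEnvelopingAlgebra k L → Prop}
    (u : UniversalEnvelopingAlgebra k L)
    (algebraMap : ∀ r, C (algebraMap k (UniversalEnvelopingAlgebra k L) r))
    (ι : ∀ x, C (UniversalEnvelopingAlgebra.ι k x)) (mul : ∀ a b, C a → C b → C (a * b))
    (add : ∀ a b, C a → C b → C (a + b)) : C u := by
  obtain ⟨t, rfl⟩ : ∃ t, UniversalEnvelopingAlgebra.mkAlgHom k L t = u :=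
    RingCon.mkₐ_surjective _ u
  induction t using TensorAlgebra.induction with
  | algebraMap r => rw [AlgHom.commutes]; exact algebraMap r
  | ι x => exact ι x
  | mul a b ha hb => rw [map_mul]; exact mul _ _ ha hb
  | add a b ha hb => rw [map_add]; exact add _ _ ha hb

variable (B : LieSubalgebra k L) (χ : LieAlgebra.LieCharacter k B)
  {M : Type*} [AddCommGroup M] [Module k M] [LieRingModule L M] [LieModule k L M]

namespace Induced

/-- The canonical generator of the induced module. -/
def gen : Induced B χ := Submodule.Quotient.mk 1

theorem lie_gen (x : B) : ⁅(x : L), gen B χ⁆ = χ x • gen B χ := by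
  rw [← algebraMap_smul (UniversalEnvelopingAlgebra k L) (χ x) (gen B χ)]
  change UniversalEnvelopingAlgebra.ι k (x : L) • gen B χ = _
  rw [← sub_eq_zero, ← sub_smul]
  refine (Submodule.Quotient.mk_eq_zero _).2 (Submodule.subset_span ⟨x, ?_⟩)
  exact (mul_one _).symm

theorem exists_eq_smul_gen (m : Induced B χ) :
    ∃ u : UniversalEnvelopingAlgebra k L, u • gen B χ = m := by
  obtain ⟨u, rfl⟩ := Submodule.Quotient.mk_surjective _ m
  refine ⟨u, ?_⟩
  change Submodule.Quotient.mk (u • 1) = _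
  rw [smul_eq_mul, mul_one]

variable {B χ}

theorem smul_mem (N : LieSubmodule k L (Induced B χ)) (u : UniversalEnvelopingAlgebra k L) :
    ∀ m ∈ N, u • m ∈ N := by
  induction u using universalEnveloping_induction with
  | algebraMap r => intro m hm; rw [algebraMap_smul]; exact N.smul_mem r hm
  | ι x => exact fun m hm => N.lie_mem hm
  | mul a b ha hb => intro m hm; rw [mul_smul]; exact ha _ (hb m hm)
  | add a b ha hb => intro m hm; rw [add_smul]; exact add_mem (ha m hm) (hb m hm)

theorem eq_top_of_gen_mem {N : LieSubmodule k L (Induced B χ)} (hN : gen B χ ∈ N) : N = ⊤ := by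
  rw [eq_top_iff]
  rintro m -
  obtain ⟨u, rfl⟩ := exists_eq_smul_gen B χ m
  exact smul_mem N u _ hN

/-- The universal property of the induced module. -/
theorem exists_hom {v : M} (hv : ∀ x : B, ⁅(x : L), v⁆ = χ x • v) :
    ∃ F : Induced B χ →ₗ⁅k, L⁆ M, F (gen B χ) = v := by
  let ρ : UniversalEnvelopingAlgebra k L →ₐ[k] Module.End k M :=
    UniversalEnvelopingAlgebra.lift k (LieModule.toEnd k L M)
  have hρ (x : L) (m : M) : ρ (UniversalEnvelopingAlgebra.ι k x) m = ⁅x, m⁆ :=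
    congr($(UniversalEnvelopingAlgebra.lift_ι_apply k (LieModule.toEnd k L M) x) m)
  let : Module (UniversalEnvelopingAlgebra k L) M := Module.compHom M ρ.toRingHom
  have hsmul (u : UniversalEnvelopingAlgebra k L) (m : M) : u • m = ρ u m := rfl
  let G : (UniversalEnvelopingAlgebra k L ⧸
      Submodule.span (UniversalEnvelopingAlgebra k L) (Set.range fun x : B =>
        UniversalEnvelopingAlgebra.ι k (x : L) -
          algebraMap k (UniversalEnvelopingAlgebra k L) (χ x)))
      →ₗ[UniversalEnvelopingAlgebra k L] M :=
    Submodule.liftQ _ (LinearMap.toSpanSingleton (UniversalEnvelopingAlgebra k L) M v) <| by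
      rw [Submodule.span_le]
      rintro _ ⟨x, rfl⟩
      change (UniversalEnvelopingAlgebra.ι k (x : L) -
        algebraMap k (UniversalEnvelopingAlgebra k L) (χ x)) • v = 0
      rw [hsmul, map_sub, LinearMap.sub_apply, hρ, hv, AlgHom.commutes,
        Module.algebraMap_end_apply, sub_self]
  let F : Induced B χ →ₗ[UniversalEnvelopingAlgebra k L] M := G
  refine ⟨{ toFun := F, map_add' := F.map_add, map_smul' := fun c m => ?_, map_lie' := ?_ }, ?_⟩
  · rw [← algebraMap_smul (UniversalEnvelopingAlgebra k L) c m, F.map_smul, hsmul,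
      AlgHom.commutes, Module.algebraMap_end_apply]
    rfl
  · intro x m
    exact (F.map_smul _ m).trans (hρ x _)
  · exact one_smul (UniversalEnvelopingAlgebra k L) v

end Induced

end InducedModule

/-! ### Uniqueness of the irreducible highest-weight module. -/

section Verma

variable {k : Type*} [Field k]

/-- The canonical highest-weight vector of the Verma module. -/
abbrev vermaGen (φ : ℤ → k) : Verma φ := Induced.gen (borel k) (weightCharacter φ)

theorem isHighestWeight_vermaGen (φ : ℤ → k) : IsHighestWeight φ (vermaGen φ) where
  h_lie a := by
    have := Induced.lie_gen (borel k) (weightCharacter φ)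
      ⟨loopElt (h k) a, Submodule.mem_sup_left ⟨a, rfl⟩⟩
    rw [← weightFunctional_h]
    exact this
  e_lie a := by
    have := Induced.lie_gen (borel k) (weightCharacter φ)
      ⟨loopElt (e k) a, Submodule.mem_sup_right ⟨a, rfl⟩⟩
    rw [← zero_smul k, ← weightFunctional_e φ a]
    exact this
  eq_top N hN := Induced.eq_top_of_gen_mem hN

variable {M : Type*} [AddCommGroup M] [Module k M]
  [LieRingModule (LoopSL2 k) M] [LieModule k (LoopSL2 k) M]

theorem exists_verma_hom {φ : ℤ → k} {v : M}
    (hh : ∀ a, ⁅loopElt (h k) a, v⁆ = laurentAction k a φ 0 • v)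
    (he : ∀ a, ⁅loopElt (e k) a, v⁆ = 0) :
    ∃ F : Verma φ →ₗ⁅k, LoopSL2 k⁆ M, F (vermaGen φ) = v := by
  refine Induced.exists_hom ?_
  rintro ⟨x, hx⟩
  obtain ⟨_, ⟨a, rfl⟩, _, ⟨b, rfl⟩, rfl⟩ := Submodule.mem_sup.1 hx
  change ⁅loopElt (h k) a + loopElt (e k) b, v⁆ =
    weightFunctional φ (loopElt (h k) a + loopElt (e k) b) • v
  rw [add_lie, hh, he, map_add, weightFunctional_h, weightFunctional_e]
  simp

variable [CharZero k]

theorem sumProper_le_lower (φ : ℤ → k) :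
    (sumProper k (LoopSL2 k) (Verma φ)).toSubmodule ≤ lower (vermaGen φ) := by
  rw [sumProper, LieSubmodule.sSup_toSubmodule]
  refine sSup_le ?_
  rintro _ ⟨N, hN, rfl⟩
  exact (isHighestWeight_vermaGen φ).le_lower hN

/-- The module `L(φ)` is isomorphic to every irreducible module of highest weight `φ`. -/
theorem nonempty_irred_equiv {φ : ℤ → k} {v : M} (hv : IsIrreducibleHighestWeight φ v) :
    Nonempty (Irred φ ≃ₗ⁅k, LoopSL2 k⁆ M) := by
  obtain ⟨F, hF⟩ := exists_verma_hom hv.h_lie hv.e_lie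
  have hgen : vermaGen φ ≠ 0 := fun h0 => hv.ne_zero (by rw [← hF, h0, map_zero])
  have hsurj : Function.Surjective F := by
    rw [← LieModuleHom.range_eq_top]
    exact hv.eq_top _ ⟨vermaGen φ, hF⟩
  have hker : F.ker = sumProper k (LoopSL2 k) (Verma φ) := by
    refine le_antisymm (le_sSup fun htop => hv.ne_zero ?_) ?_
    · have : vermaGen φ ∈ F.ker := by rw [htop]; trivial
      rw [← hF]
      exact LieModuleHom.mem_ker.1 this
    -- If the image were everything, some `n` in the sum of proper submodules would map to `v`; then
    -- `vermaGen φ - n` lies in the proper kernel, which puts `vermaGen φ` in its own lower part.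
    · rw [LieModuleHom.le_ker_iff_map]
      refine hv.eq_bot _ fun htop => ?_
      have hv_mem : v ∈ LieSubmodule.map F (sumProper k (LoopSL2 k) (Verma φ)) := by
        rw [htop]; trivial
      obtain ⟨n, hn, hnv⟩ := (LieSubmodule.mem_map v).1 hv_mem
      have hsub : vermaGen φ - n ∈ F.ker := by
        rw [LieModuleHom.mem_ker, map_sub, hF, hnv, sub_self]
      have hne : F.ker ≠ ⊤ := fun h => hv.ne_zero <| by
        rw [← hF]
        exact LieModuleHom.mem_ker.1 (by rw [h]; trivial)
      refine (isHighestWeight_vermaGen φ).notMem_lower hgen ?_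
      have := add_mem ((isHighestWeight_vermaGen φ).le_lower hne hsub) (sumProper_le_lower φ hn)
      rwa [sub_add_cancel] at this
  let G : Irred φ →ₗ[k] M := Submodule.liftQ (sumProper k (LoopSL2 k) (Verma φ)).toSubmodule
    (F : Verma φ →ₗ[k] M) (fun m hm => by
      rw [← hker] at hm
      exact LieModuleHom.mem_ker.1 hm)
  have hG (m : Verma φ) : G (LieSubmodule.Quotient.mk m) = F m := rfl
  have hbij : Function.Bijective G := by
    constructor
    · rw [injective_iff_map_eq_zero]
      intro m hm
      obtain ⟨m, rfl⟩ := LieSubmodule.Quotient.surjective_mk' _ m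
      rw [LieSubmodule.Quotient.mk_eq_zero, ← hker]
      exact LieModuleHom.mem_ker.2 hm
    · intro m
      obtain ⟨n, rfl⟩ := hsurj m
      exact ⟨LieSubmodule.Quotient.mk n, rfl⟩
  let E := LinearEquiv.ofBijective G hbij
  refine ⟨{ toFun := G, map_add' := G.map_add, map_smul' := G.map_smul, map_lie' := ?_,
            invFun := E.symm, left_inv := E.left_inv, right_inv := E.right_inv }⟩
  intro x m
  obtain ⟨m, rfl⟩ := LieSubmodule.Quotient.surjective_mk' _ m
  exact F.map_lie x m

/-- The canonical highest-weight vector of `L(φ)`. -/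
abbrev irredGen (φ : ℤ → k) : Irred φ := LieSubmodule.Quotient.mk (vermaGen φ)

theorem isIrreducibleHighestWeight_irredGen {φ : ℤ → k} (h0 : vermaGen φ ≠ 0) :
    IsIrreducibleHighestWeight φ (irredGen φ) where
  h_lie a := congr(LieSubmodule.Quotient.mk' (sumProper k (LoopSL2 k) (Verma φ))
    $((isHighestWeight_vermaGen φ).h_lie a))
  e_lie a := congr(LieSubmodule.Quotient.mk' (sumProper k (LoopSL2 k) (Verma φ))
    $((isHighestWeight_vermaGen φ).e_lie a))
  eq_top N hN := by
    have hcomap : N.comap (LieSubmodule.Quotient.mk' (sumProper k (LoopSL2 k) (Verma φ))) = ⊤ :=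
      (isHighestWeight_vermaGen φ).eq_top _ hN
    rw [eq_top_iff]
    rintro m -
    obtain ⟨m, rfl⟩ := LieSubmodule.Quotient.surjective_mk' _ m
    change m ∈ N.comap _
    rw [hcomap]; trivial
  ne_zero hzero := (isHighestWeight_vermaGen φ).notMem_lower h0
    (sumProper_le_lower φ ((LieSubmodule.Quotient.mk_eq_zero _).1 hzero))
  eq_bot N hN := by
    let π := LieSubmodule.Quotient.mk' (sumProper k (LoopSL2 k) (Verma φ))
    have hle : N.comap π ≤ sumProper k (LoopSL2 k) (Verma φ) := le_sSup fun htop => hN <| by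
      rw [eq_top_iff]
      rintro m -
      obtain ⟨m, rfl⟩ := LieSubmodule.Quotient.surjective_mk' _ m
      change m ∈ N.comap π
      rw [htop]; trivial
    rw [eq_bot_iff]
    intro m hm
    obtain ⟨m, rfl⟩ := LieSubmodule.Quotient.surjective_mk' _ m
    exact (LieSubmodule.mem_bot _).2 ((LieSubmodule.Quotient.mk_eq_zero _).2 (hle hm))

end Verma

/-! ### Linear maps out of Laurent polynomials. -/

section LaurentExtension

variable {k : Type*} [Field k] {V : Type*} [AddCommGroup V] [Module k V]

theorem laurent_induction {p : k[T;T⁻¹] → Prop} (a : k[T;T⁻¹])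
    (T : ∀ n, p (LaurentPolynomial.T n)) (smul : ∀ (c : k) a, p a → p (c • a))
    (add : ∀ a b, p a → p b → p (a + b)) : p a := by
  induction a using LaurentPolynomial.induction_on' with
  | add a b ha hb => exact add a b ha hb
  | C_mul_T n c => rw [← LaurentPolynomial.smul_eq_C_mul]; exact smul c _ (T n)

theorem laurent_hom_ext {S R : k[T;T⁻¹] →ₗ[k] V}
    (H : ∀ n, S (LaurentPolynomial.T n) = R (LaurentPolynomial.T n)) : S = R := by
  refine LinearMap.ext fun a => ?_
  induction a using laurent_induction with
  | T n => exact H n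
  | smul c a ha => rw [map_smul, map_smul, ha]
  | add a b ha hb => rw [map_add, map_add, ha, hb]

/-- The linear map on Laurent polynomials with prescribed values on the powers of `T`. -/
def laurentExtend (g : ℤ → V) : k[T;T⁻¹] →ₗ[k] V :=
  Finsupp.linearCombination k g ∘ₗ (AddMonoidAlgebra.coeffLinearEquiv k).toLinearMap

theorem laurentExtend_T (g : ℤ → V) (n : ℤ) :
    laurentExtend (k := k) g (LaurentPolynomial.T n) = g n := by
  refine (Finsupp.linearCombination_single k 1 n).trans (one_smul k _)

end LaurentExtension

/-! ### A Fock-space action showing that the Verma module is nonzero. -/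

section Fock

open MvPolynomial

variable {k : Type*} [Field k]

/-- Applied below to the defect of each bracket relation: the defect kills `1` and commutes with
multiplication by variables. -/
theorem fock_hom_ext {S : Module.End k (MvPolynomial ℤ k)} (h1 : S 1 = 0)
    (hX : ∀ p q, S (X p * q) = X p * S q) : S = 0 := by
  refine LinearMap.ext fun q => ?_
  induction q using MvPolynomial.induction_on with
  | C a => rw [C_eq_smul_one, map_smul, h1, smul_zero]; rfl
  | add p q hp hq => rw [map_add, map_add, hp, hq]
  | mul_X q p hq => rw [mul_comm, hX, hq, LinearMap.zero_apply, LinearMap.zero_apply, mul_zero]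

variable (k) in
/-- The derivation of the polynomial ring with `X m ↦ X (m + n)`. -/
def fockShift (n : ℤ) : Derivation k (MvPolynomial ℤ k) (MvPolynomial ℤ k) :=
  mkDerivation k fun m => X (m + n)

variable (k) in
/-- The gradient of a polynomial. -/
def fockGradient : Derivation k (MvPolynomial ℤ k) (ℤ →₀ MvPolynomial ℤ k) :=
  mkDerivation k fun m => Finsupp.single m 1

variable (k) in
/-- The operator by which `f ⊗ T n` acts. -/
def fockF (n : ℤ) : Module.End k (MvPolynomial ℤ k) := LinearMap.mulLeft k (X n)

variable (φ : ℤ → k)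

/-- The operator by which `h ⊗ T n` acts. -/
def fockH (n : ℤ) : Module.End k (MvPolynomial ℤ k) :=
  φ n • LinearMap.id - (2 : k) • (fockShift k n : Module.End k (MvPolynomial ℤ k))

/-- The sum of the operators `φ (m + n) - fockShift (m + n)` applied to the `m`-th entries. -/
def fockContract (n : ℤ) : (ℤ →₀ MvPolynomial ℤ k) →ₗ[k] MvPolynomial ℤ k :=
  Finsupp.lsum k fun m : ℤ =>
    φ (m + n) • LinearMap.id - (fockShift k (m + n) : Module.End k (MvPolynomial ℤ k))

/-- The operator by which `e ⊗ T n` acts. -/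
def fockE (n : ℤ) : Module.End k (MvPolynomial ℤ k) :=
  fockContract φ n ∘ₗ (fockGradient k : MvPolynomial ℤ k →ₗ[k] ℤ →₀ MvPolynomial ℤ k)

theorem fockH_apply (n : ℤ) (q : MvPolynomial ℤ k) :
    fockH φ n q = φ n • q - (2 : k) • fockShift k n q := rfl

theorem fockShift_X_mul (n p : ℤ) (q : MvPolynomial ℤ k) :
    fockShift k n (X p * q) = X p * fockShift k n q + X (p + n) * q := by
  rw [Derivation.leibniz, fockShift, mkDerivation_X, smul_eq_mul, smul_eq_mul, mul_comm q]

theorem fockH_X_mul (n p : ℤ) (q : MvPolynomial ℤ k) :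
    fockH φ n (X p * q) = X p * fockH φ n q - (2 : k) • (X (p + n) * q) := by
  rw [fockH_apply, fockH_apply, fockShift_X_mul, smul_add, mul_sub, mul_smul_comm, mul_smul_comm]
  abel

theorem fockH_one (n : ℤ) : fockH φ n 1 = φ n • 1 := by
  rw [fockH_apply, Derivation.map_one_eq_zero, smul_zero, sub_zero]

theorem fockE_one (n : ℤ) : fockE φ n 1 = 0 := by
  change fockContract φ n (fockGradient k 1) = 0
  rw [Derivation.map_one_eq_zero, map_zero]

theorem fockContract_single (n p : ℤ) (q : MvPolynomial ℤ k) :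
    fockContract φ n (Finsupp.single p q) = φ (p + n) • q - fockShift k (p + n) q := by
  rw [fockContract, Finsupp.lsum_single]
  rfl

theorem fockContract_X_smul (n p : ℤ) (s : ℤ →₀ MvPolynomial ℤ k) :
    fockContract φ n ((X p : MvPolynomial ℤ k) • s) =
      X p * fockContract φ n s - s.sum fun m q => X (p + n + m) * q := by
  induction s using Finsupp.induction_linear with
  | zero => simp
  | add s t hs ht =>
    rw [smul_add, map_add, map_add, hs, ht, Finsupp.sum_add_index' (by simp)
      (fun _ _ _ => mul_add _ _ _), mul_add]
    abel
  | single m q =>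
    rw [Finsupp.smul_single, fockContract_single, fockContract_single, smul_eq_mul,
      fockShift_X_mul, Finsupp.sum_single_index (mul_zero _), mul_sub, mul_smul_comm,
      show p + (m + n) = p + n + m by ring]
    abel

/-- The chain rule: the derivation sending `X m` to `X (n + m)` is `∑ X (n + m) ∂_m`. -/
theorem fockGradient_sum (n : ℤ) (q : MvPolynomial ℤ k) :
    ((fockGradient k q).sum fun m r => X (n + m) * r) = fockShift k n q := by
  induction q using MvPolynomial.induction_on with
  | C a =>
    rw [← algebraMap_eq, Derivation.map_algebraMap, Derivation.map_algebraMap,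
      Finsupp.sum_zero_index]
  | add p q hp hq =>
    rw [map_add, map_add, Finsupp.sum_add_index' (by simp) (fun _ _ _ => mul_add _ _ _), hp, hq]
  | mul_X q p hq =>
    rw [mul_comm, fockShift_X_mul, Derivation.leibniz,
      Finsupp.sum_add_index' (by simp) (fun _ _ _ => mul_add _ _ _),
      Finsupp.sum_smul_index' (by simp), ← hq, Finsupp.mul_sum, fockGradient, mkDerivation_X,
      Finsupp.smul_single, Finsupp.sum_single_index (mul_zero _), smul_eq_mul, mul_one, add_comm n]
    simp only [smul_eq_mul, mul_left_comm]

/-- This is the relation `[e, f] = h`. One copy of `fockShift k (p + n)` comes from commuting `X p`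
past the contraction, the other from differentiating `X p`; together they give the factor `2` in
`fockH`. -/
theorem fockE_X_mul (n p : ℤ) (q : MvPolynomial ℤ k) :
    fockE φ n (X p * q) = X p * fockE φ n q + fockH φ (p + n) q := by
  change fockContract φ n (fockGradient k (X p * q)) =
    X p * fockContract φ n (fockGradient k q) + _
  rw [Derivation.leibniz, map_add, fockContract_X_smul, fockGradient_sum]
  nth_rw 2 [fockGradient]
  rw [mkDerivation_X, Finsupp.smul_single, smul_eq_mul, mul_one, fockContract_single, fockH_apply,
    two_smul]
  abel

theorem fockH_comm (m n : ℤ) (q : MvPolynomial ℤ k) :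
    fockH φ m (fockH φ n q) = fockH φ n (fockH φ m q) := by
  have : fockH φ m * fockH φ n - fockH φ n * fockH φ m = 0 := by
    refine fock_hom_ext ?_ fun p q => ?_
    · simp only [LinearMap.sub_apply, Module.End.mul_apply, fockH_one, map_smul, smul_smul,
        mul_comm, sub_self]
    · simp only [LinearMap.sub_apply, Module.End.mul_apply, fockH_X_mul, map_sub, map_smul,
        smul_sub, mul_sub, add_right_comm p n m]
      abel
  exact sub_eq_zero.1 congr($this q)

theorem fockH_fockE (m n : ℤ) (q : MvPolynomial ℤ k) :
    fockH φ m (fockE φ n q) = fockE φ n (fockH φ m q) + (2 : k) • fockE φ (m + n) q := by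
  have : fockH φ m * fockE φ n - fockE φ n * fockH φ m - (2 : k) • fockE φ (m + n) = 0 := by
    refine fock_hom_ext ?_ fun p q => ?_
    · simp [fockH_one, fockE_one]
    · simp only [LinearMap.sub_apply, LinearMap.smul_apply, Module.End.mul_apply, fockH_X_mul,
        fockE_X_mul, map_sub, map_add, map_smul, smul_add, mul_sub, mul_smul_comm,
        fockH_comm φ m, add_assoc p]
      abel
  have := congr($this q)
  simp only [LinearMap.sub_apply, LinearMap.smul_apply, Module.End.mul_apply,
    LinearMap.zero_apply] at this
  rw [← sub_eq_zero, ← this]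
  abel

theorem fockE_comm (m n : ℤ) (q : MvPolynomial ℤ k) :
    fockE φ m (fockE φ n q) = fockE φ n (fockE φ m q) := by
  have : fockE φ m * fockE φ n - fockE φ n * fockE φ m = 0 := by
    refine fock_hom_ext ?_ fun p q => ?_
    · simp [fockE_one]
    · simp only [LinearMap.sub_apply, Module.End.mul_apply, fockE_X_mul, map_add, mul_sub,
        fockH_fockE, add_right_comm p n m]
      abel
  exact sub_eq_zero.1 congr($this q)

/-- The action of `x ⊗ T n` on the Fock space. -/
def fockOp (n : ℤ) : SL2 k →ₗ[k] Module.End k (MvPolynomial ℤ k) :=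
  { toFun := fun x => (x : Matrix (Fin 2) (Fin 2) k) 0 0 • fockH φ n +
      (x : Matrix (Fin 2) (Fin 2) k) 0 1 • fockE φ n +
      (x : Matrix (Fin 2) (Fin 2) k) 1 0 • fockF k n
    map_add' := fun x y => by
      have hxy (i j : Fin 2) : ((x + y : SL2 k) : Matrix (Fin 2) (Fin 2) k) i j =
        (x : Matrix (Fin 2) (Fin 2) k) i j + (y : Matrix (Fin 2) (Fin 2) k) i j := rfl
      simp only [hxy, add_smul]
      abel
    map_smul' := fun c x => by
      have hcx (i j : Fin 2) : ((c • x : SL2 k) : Matrix (Fin 2) (Fin 2) k) i j =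
        c * (x : Matrix (Fin 2) (Fin 2) k) i j := rfl
      simp only [hcx, mul_smul, smul_add, RingHom.id_apply] }

theorem fockOp_apply (n : ℤ) (x : SL2 k) (q : MvPolynomial ℤ k) :
    fockOp φ n x q = (x : Matrix (Fin 2) (Fin 2) k) 0 0 • fockH φ n q +
      (x : Matrix (Fin 2) (Fin 2) k) 0 1 • fockE φ n q +
      (x : Matrix (Fin 2) (Fin 2) k) 1 0 • (X n * q) := rfl

theorem fockOp_lie (m n : ℤ) (x y : SL2 k) :
    fockOp φ (m + n) ⁅x, y⁆ = fockOp φ m x * fockOp φ n y - fockOp φ n y * fockOp φ m x := by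
  have hx : (x : Matrix (Fin 2) (Fin 2) k) 1 1 = -(x : Matrix (Fin 2) (Fin 2) k) 0 0 := by
    have := x.2
    exact eq_neg_of_add_eq_zero_right ((Matrix.trace_fin_two _).symm.trans this)
  have hy : (y : Matrix (Fin 2) (Fin 2) k) 1 1 = -(y : Matrix (Fin 2) (Fin 2) k) 0 0 := by
    have := y.2
    exact eq_neg_of_add_eq_zero_right ((Matrix.trace_fin_two _).symm.trans this)
  refine LinearMap.ext fun q => ?_
  simp only [fockOp_apply, LinearMap.sub_apply, Module.End.mul_apply, map_add, map_smul,
    fockH_X_mul, fockE_X_mul, fockH_fockE, smul_add, smul_sub,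
    fockH_comm φ n m, fockE_comm φ n m, add_comm n m, mul_left_comm (X n) (X m) q,
    LieAlgebra.SpecialLinear.sl_bracket, Matrix.sub_apply, Matrix.mul_apply, Fin.sum_univ_two,
    hx, hy]
  module

/-- The action of the loop algebra on the Fock space. -/
def fockRep : LoopSL2 k →ₗ[k] Module.End k (MvPolynomial ℤ k) :=
  TensorProduct.lift (laurentExtend (fockOp φ))

theorem fockRep_loopElt (x : SL2 k) (a : k[T;T⁻¹]) :
    fockRep φ (loopElt x a) = laurentExtend (fockOp φ) a x :=
  TensorProduct.lift.tmul a x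

theorem fockRep_loopElt_T (x : SL2 k) (n : ℤ) :
    fockRep φ (loopElt x (LaurentPolynomial.T n)) = fockOp φ n x := by
  rw [fockRep_loopElt, laurentExtend_T]

theorem fockRep_lie (y z : LoopSL2 k) :
    fockRep φ ⁅y, z⁆ = fockRep φ y * fockRep φ z - fockRep φ z * fockRep φ y := by
  induction y using loop_induction with
  | add y y' hy hy' => rw [add_lie, map_add, map_add, hy, hy', add_mul, mul_add]; abel
  | elt x a =>
    induction z using loop_induction with
    | add z z' hz hz' => rw [lie_add, map_add, map_add, hz, hz', add_mul, mul_add]; abel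
    | elt y b =>
      rw [lie_loopElt]
      induction a using laurent_induction with
      | smul c a ha => simp only [smul_mul_assoc, mul_smul_comm, map_smul, ha, smul_sub]
      | add a a' ha ha' => simp only [add_mul, mul_add, map_add, ha, ha']; abel
      | T m =>
        induction b using laurent_induction with
        | smul c b hb => simp only [smul_mul_assoc, mul_smul_comm, map_smul, hb, smul_sub]
        | add b b' hb hb' => simp only [add_mul, mul_add, map_add, hb, hb']; abel
        | T n =>
          rw [← LaurentPolynomial.T_add, fockRep_loopElt_T, fockRep_loopElt_T,
            fockRep_loopElt_T, fockOp_lie]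

theorem fockRep_h_one (a : k[T;T⁻¹]) :
    fockRep φ (loopElt (h k) a) 1 = laurentAction k a φ 0 • 1 := by
  let ev : Module.End k (MvPolynomial ℤ k) →ₗ[k] MvPolynomial ℤ k := LinearMap.applyₗ 1
  let wt : k[T;T⁻¹] →ₗ[k] k := LinearMap.proj 0 ∘ₗ LinearMap.applyₗ φ ∘ₗ
    (laurentAction k).toLinearMap
  have : ev ∘ₗ fockRep φ ∘ₗ loopElt (h k) = (LinearMap.toSpanSingleton k _ 1) ∘ₗ wt := by
    refine laurent_hom_ext fun n => ?_
    change fockRep φ (loopElt (h k) (LaurentPolynomial.T n)) 1 =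
      laurentAction k (LaurentPolynomial.T n) φ 0 • 1
    rw [fockRep_loopElt_T, laurentAction_T, fockOp_apply, fockH_one]
    simp [h]
  exact congr($this a)

theorem fockRep_e_one (a : k[T;T⁻¹]) : fockRep φ (loopElt (e k) a) 1 = 0 := by
  let ev : Module.End k (MvPolynomial ℤ k) →ₗ[k] MvPolynomial ℤ k := LinearMap.applyₗ 1
  have : ev ∘ₗ fockRep φ ∘ₗ loopElt (e k) = 0 := by
    refine laurent_hom_ext fun n => ?_
    change fockRep φ (loopElt (e k) (LaurentPolynomial.T n)) 1 = 0
    rw [fockRep_loopElt_T, fockOp_apply, fockE_one]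
    simp [e]
  exact congr($this a)

/-- In the Fock space the polynomial `1` satisfies the highest-weight relations, so the universal
property sends the generator to `1 ≠ 0`. -/
theorem vermaGen_ne_zero : vermaGen φ ≠ 0 := by
  let : LieRingModule (LoopSL2 k) (MvPolynomial ℤ k) :=
    { bracket := fun x q => fockRep φ x q
      add_lie := fun x y q => congr($(map_add (fockRep φ) x y) q)
      lie_add := fun x => map_add (fockRep φ x)
      leibniz_lie := fun x y q => by
        change fockRep φ x (fockRep φ y q) = fockRep φ ⁅x, y⁆ q + fockRep φ y (fockRep φ x q)
        rw [fockRep_lie]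
        exact (sub_add_cancel _ _).symm }
  have : LieModule k (LoopSL2 k) (MvPolynomial ℤ k) :=
    { smul_lie := fun c x q => congr($(map_smul (fockRep φ) c x) q)
      lie_smul := fun c x => map_smul (fockRep φ x) c }
  obtain ⟨F, hF⟩ := exists_verma_hom (φ := φ) (v := (1 : MvPolynomial ℤ k))
    (fockRep_h_one φ) (fockRep_e_one φ)
  intro h0
  rw [h0, map_zero] at hF
  exact zero_ne_one hF

end Fock

/-! ### Characteristic polynomials annihilate their functions. -/

section CharPoly

variable {k : Type*} [Field k]

theorem laurentAction_charPoly (φ : ℤ → k) :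
    laurentAction k (Polynomial.toLaurent (charPoly φ)) φ = 0 :=
  (annihilator φ).mul_mem_left _ (Submodule.IsPrincipal.generator_mem (annihilator φ))

theorem laurentAction_mul_charPoly (φ : ℤ → k) (u : Polynomial k) :
    laurentAction k (Polynomial.toLaurent (u * charPoly φ)) φ = 0 := by
  rw [map_mul, map_mul, Module.End.mul_apply, laurentAction_charPoly, map_zero]

end CharPoly

end ExpPolyLoop

end

theorem mainTheorem5 {k : Type*} [Field k] [IsAlgClosed k] [CharZero k]
    (φ₁ φ₂ : ℤ → k) (h₁ : ExpPolyLoop.IsExpPoly φ₁) (h₂ : ExpPolyLoop.IsExpPoly φ₂)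
    (hcop : IsCoprime (ExpPolyLoop.charPoly φ₁) (ExpPolyLoop.charPoly φ₂)) :
    Nonempty (ExpPolyLoop.Irred (φ₁ + φ₂) ≃ₗ⁅k, ExpPolyLoop.LoopSL2 k⁆
      ExpPolyLoop.Irred φ₁ ⊗[k] ExpPolyLoop.Irred φ₂) := by
  obtain ⟨u, w, huw⟩ := hcop
  have hv₁ := ExpPolyLoop.isIrreducibleHighestWeight_irredGen (ExpPolyLoop.vermaGen_ne_zero φ₁)
  have hv₂ := ExpPolyLoop.isIrreducibleHighestWeight_irredGen (ExpPolyLoop.vermaGen_ne_zero φ₂)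
  -- The two terms of the Bézout identity are the separating pair, each annihilating its own weight
  -- function.
  have hp : ExpPolyLoop.IsSeparating (Polynomial.toLaurent (u * ExpPolyLoop.charPoly φ₁))
      (Polynomial.toLaurent (w * ExpPolyLoop.charPoly φ₂))
      (ExpPolyLoop.Irred φ₁) (ExpPolyLoop.Irred φ₂) :=
    { add_eq_one := by rw [← map_add, huw, map_one]
      left := hv₁.lie_eq_zero (ExpPolyLoop.laurentAction_mul_charPoly φ₁ u)
      right := hv₂.lie_eq_zero (ExpPolyLoop.laurentAction_mul_charPoly φ₂ w) }
  exact ExpPolyLoop.nonempty_irred_equiv (hp.isIrreducibleHighestWeight_tmul hv₁ hv₂)
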